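/- Let $D\ge 0$, $d\ge 1$, $B>0$, and let $p_{\mathcal D}$ be a probability distribution on $\mathbb R^D$ with finite covariance (finite second moment) that is not a single point mass. Consider, for each $\beta$, the variational autoencoder with encoder $q(z\mid x)=\mathcal N(z\mid f_\beta(x),\sigma_\beta^2 I_d)$, decoder $p(x\mid z)=\mathcal N(x\mid g_\beta(z),s_\beta^2 I_D)$ and prior $p(z)=\mathcal N(0,I_d)$, and the rescaled objective $$\mathcal L_\beta=\mathbb E_{x\sim p_{\mathcal D}}\Bigl[(B-\beta)\,\mathbb E_{z\sim q(z\mid x)}[\log p(x\mid z)]-\beta\,\mathrm{KL}\bigl(q(z\mid x)\,\|\,p(z)\bigr)\Bigr]\in[-\infty,\infty].$$ The encoder mean $f_\beta:\mathbb R^D\to\mathbb R^d$ ranges over all Lipschitz functions (with no bound on the Lipschitz constant), the decoder mean $g_\beta:\mathbb R^d\to\mathbb R^D$ over all measurable functions, the encoder variance $\sigma_\beta^2$ over $[0,\infty)$, and the decoder variance $s_\beta^2$ over a set $S\subseteq(0,\infty)$ of allowed values that does not depend on $\beta$ (for example a single fixed value, or all of $(0,\infty)$). A global optimum of $\mathcal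 L_\beta$ is a joint maximizer $(f_\beta,g_\beta,\sigma_\beta^2,s_\beta^2)$. Then at the global optimum of $\mathcal L_\beta$ one has $\sigma_\beta^2\to 0$ as $\beta\to 0$: for every $\varepsilon>0$ there is $\beta_0>0$ such that for every $\beta\in(0,\beta_0)$ every global optimum of $\mathcal L_\beta$ has $\sigma_\beta^2<\varepsilon$. Moreover, every global optimum of $\mathcal L_0$ has $\sigma_0^2=0$. -/

import Mathlib

open MeasureTheory ProbabilityTheory InformationTheory
open scoped NNReal ENNReal

noncomputable section

namespace BetaVAE

/-- Euclidean space of dimension `n`. -/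
abbrev E (n : ℕ) : Type := EuclideanSpace ℝ (Fin n)

/-- The isotropic Gaussian law `N(m, v I)` on Euclidean space (a point mass at `m` if `v = 0`). -/
def isoGaussian {n : ℕ} (m : E n) (v : ℝ≥0) : Measure (E n) :=
  multivariateGaussian m ((v : ℝ) • (1 : Matrix (Fin n) (Fin n) ℝ))

/-- The Lebesgue density at `x` of `N(m, v I)`, for `v > 0`. -/
def isoGaussianPDF {n : ℕ} (m : E n) (v : ℝ≥0) (x : E n) : ℝ :=
  (2 * Real.pi * v) ^ (-(n : ℝ) / 2) * Real.exp (-‖x - m‖ ^ 2 / (2 * v))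

/-- Expectation of an extended-real-valued function: integral of the positive part minus
integral of the negative part. It is used only where the positive part has a finite integral. -/
def expect {Ω : Type} [MeasurableSpace Ω] (P : Measure Ω) (h : Ω → EReal) : EReal :=
  ((∫⁻ ω, (h ω).toENNReal ∂P : ℝ≥0∞) : EReal) - ((∫⁻ ω, (-h ω).toENNReal ∂P : ℝ≥0∞) : EReal)

/-- The parameters of the model at one value of `β`: data dimension `D`, latent dimension `d`.
The encoder is `q(z | x) = N(z | encMean x, encVar I)`, with a Lipschitz mean;
the decoder is `p(x | z) = N(x | decMean z, decVar I)`, with a measurable mean. -/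
structure Params (D d : ℕ) where
  encMean : E D → E d
  encVar : ℝ≥0
  decMean : E d → E D
  decVar : ℝ≥0
  lipschitz_encMean : ∃ K : ℝ≥0, LipschitzWith K encMean
  measurable_decMean : Measurable decMean

/-- The encoder distribution `q(z | x)`. -/
def Params.encoder {D d : ℕ} (p : Params D d) (x : E D) : Measure (E d) :=
  isoGaussian (p.encMean x) p.encVar

/-- The decoder density `p(x | z)`. -/
def Params.decoderPDF {D d : ℕ} (p : Params D d) (z : E d) (x : E D) : ℝ :=
  isoGaussianPDF (p.decMean z) p.decVar x

/-- The rescaled evidence lower bound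
`L_β = E_{x ∼ μ} [ (B - β) E_{z ∼ q(z|x)} [log p(x|z)] - β KL(q(z|x) ‖ N(0, I)) ]`,
with values in `[-∞, ∞]`. -/
def objective {D d : ℕ} (μ : Measure (E D)) (B β : ℝ) (p : Params D d) : EReal :=
  expect μ fun x =>
    ((B - β : ℝ) : EReal) *
        expect (p.encoder x) (fun z => ((Real.log (p.decoderPDF z x) : ℝ) : EReal))
      - ((β : ℝ) : EReal) * ((klDiv (p.encoder x) (stdGaussian (E d)) : ℝ≥0∞) : EReal)

/-- `p` is a global maximizer of `L_β` jointly over all Lipschitz encoder means, all measurable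
decoder means, all encoder variances in `[0, ∞)` and all decoder variances in `S`. -/
def IsGlobalOptimum {D d : ℕ} (μ : Measure (E D)) (B : ℝ) (S : Set ℝ≥0) (β : ℝ)
    (p : Params D d) : Prop :=
  p.decVar ∈ S ∧ ∀ p' : Params D d, p'.decVar ∈ S → objective μ B β p' ≤ objective μ B β p

end BetaVAE

end

/-! For positive encoder variance the objective is `-(B - β) (D log(2πs²)/2 + R/(2s²)) - β K`, with
`R` the mean squared reconstruction error and `K` the mean divergence from the prior
(`objective_eq`). Two facts about `R` conflict unless the variance vanishes.

Lower bound (`exists_ofReal_le_reconError`): if `σ² ∈ [ε, V]` and the encoder mean has second moment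
at most `T`, then on most of the data all encoder laws dominate one fixed multiple of a Gaussian on
a ball. To that extent the latent carries no information about `x`, and since the data is not a
point mass, `R ≥ c > 0` for every decoder.

Upper bound (`exists_reconError_lt`): some encoder with positive variance has `R` as small as
desired. Its `K` is finite and fixed, so its cost `β K` disappears as `β → 0`.

The lower bound needs `T` and `V` uniform in `β`. Rescaling the latent space changes only `K`, so an
optimum with `β > 0` and positive variance has the best scale, which means `d σ² + E‖f‖² = d`
(`Params.second_moment_eq_of_le_rescale`); hence `σ² ≤ 1` and `E‖f‖² ≤ d`. The decoder variance is
bounded above by comparison with a fixed competitor. For `β = 0` only one optimum is involved and no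
uniformity is needed. -/

/-! ### Densities of product and Gaussian measures -/

/-- A product of measures with densities with respect to probability measures has the product
density. -/
theorem MeasureTheory.Measure.pi_withDensity {ι : Type*} [Fintype ι] {α : ι → Type*}
    [∀ i, MeasurableSpace (α i)] (μ : ∀ i, Measure (α i)) [∀ i, IsProbabilityMeasure (μ i)]
    (f : ∀ i, α i → ℝ≥0∞) (hf : ∀ i, Measurable (f i))
    [∀ i, SigmaFinite ((μ i).withDensity (f i))] :
    Measure.pi (fun i => (μ i).withDensity (f i)) =
      (Measure.pi μ).withDensity (fun x => ∏ i, f i (x i)) := by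
  classical
  refine Measure.pi_eq fun s hs => ?_
  rw [withDensity_apply _ (MeasurableSet.univ_pi hs),
    ← lintegral_indicator (MeasurableSet.univ_pi hs)]
  have hg : ∀ i, Measurable ((s i).indicator (f i)) := fun i => (hf i).indicator (hs i)
  have key : ((Set.univ.pi s).indicator fun x : ∀ i, α i => ∏ i, f i (x i)) =
      fun x => ∏ i, (s i).indicator (f i) (x i) := by
    funext x
    by_cases hx : x ∈ Set.univ.pi s
    · rw [Set.indicator_of_mem hx]
      exact Finset.prod_congr rfl fun i _ =>
        (Set.indicator_of_mem (hx i (Set.mem_univ i)) _).symm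
    · rw [Set.indicator_of_notMem hx]
      obtain ⟨i, hi⟩ : ∃ i, x i ∉ s i := by simpa [Set.mem_pi] using hx
      exact (Finset.prod_eq_zero (Finset.mem_univ i) (Set.indicator_of_notMem hi _)).symm
  rw [key, lintegral_prod_eq_prod_lintegral_of_indepFun Finset.univ
    (fun i (x : ∀ i, α i) => (s i).indicator (f i) (x i))
    (iIndepFun_pi fun i => (hg i).aemeasurable) (fun i => (hg i).comp (measurable_pi_apply i))]
  refine Finset.prod_congr rfl fun i _ => ?_
  rw [(measurePreserving_eval μ i).lintegral_comp (hg i), lintegral_indicator (hs i),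
    withDensity_apply _ (hs i)]

/-- The density of a one-dimensional Gaussian with respect to the standard Gaussian. -/
theorem ProbabilityTheory.gaussianReal_eq_withDensity_gaussianReal_zero_one (m : ℝ) {v : ℝ≥0}
    (hv : v ≠ 0) :
    gaussianReal m v = (gaussianReal 0 1).withDensity (fun x => ENNReal.ofReal
      (Real.exp (-(Real.log v) / 2 - (x - m) ^ 2 / (2 * v) + x ^ 2 / 2))) := by
  have hv' : (0 : ℝ) < v := by positivity
  rw [gaussianReal_of_var_ne_zero m hv, gaussianReal_of_var_ne_zero 0 one_ne_zero,
    ← withDensity_mul _ (measurable_gaussianPDF 0 1) (by fun_prop)]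
  congr 1
  funext x
  simp only [Pi.mul_apply, gaussianPDF, gaussianPDFReal]
  rw [← ENNReal.ofReal_mul (by positivity)]
  congr 1
  have h1 : √(2 * Real.pi * (v : ℝ)) = √(2 * Real.pi) * Real.exp (Real.log v / 2) := by
    rw [Real.sqrt_mul (by positivity), ← Real.log_sqrt hv'.le, Real.exp_log (by positivity)]
  rw [h1, NNReal.coe_one, mul_one, mul_inv, ← Real.exp_neg, mul_assoc, mul_assoc, ← Real.exp_add,
    ← Real.exp_add]
  congr 2
  ring

/-! ### Isotropic Gaussians: density, second moment, divergence from the prior -/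

namespace BetaVAE

variable {n : ℕ}

open scoped MatrixOrder Matrix.Norms.L2Operator in
theorem isoGaussian_eq_map (m : E n) (v : ℝ≥0) :
    isoGaussian m v = (stdGaussian (E n)).map (fun w => m + √(v : ℝ) • w) := by
  have h : CFC.sqrt ((v : ℝ) • (1 : Matrix (Fin n) (Fin n) ℝ)) = √(v : ℝ) • 1 := by
    have := CFC.sqrt_algebraMap (A := Matrix (Fin n) (Fin n) ℝ) (r := v)
    rw [Algebra.algebraMap_eq_smul_one, Algebra.algebraMap_eq_smul_one] at this
    simpa [NNReal.smul_def] using this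
  rw [isoGaussian, multivariateGaussian, h]
  simp

instance (m : E n) (v : ℝ≥0) : IsProbabilityMeasure (isoGaussian m v) := by
  rw [isoGaussian]; infer_instance

theorem measurable_add_smul (m : E n) (t : ℝ) : Measurable fun w : E n => m + t • w := by
  fun_prop

/-- The logarithm of the density of `N(m, v I)` with respect to `N(0, I)`. -/
noncomputable def logRatio (m : E n) (v : ℝ≥0) (z : E n) : ℝ :=
  -(n * Real.log v) / 2 - ‖z - m‖ ^ 2 / (2 * v) + ‖z‖ ^ 2 / 2

theorem measurable_logRatio (m : E n) (v : ℝ≥0) : Measurable (logRatio m v) := by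
  unfold logRatio; fun_prop

/-- Serves twice: its logarithm integrates to the divergence, and its lower bound on a ball makes
different encoder laws comparable. -/
theorem isoGaussian_eq_withDensity (m : E n) {v : ℝ≥0} (hv : v ≠ 0) :
    isoGaussian m v = (stdGaussian (E n)).withDensity
      (fun z => ENNReal.ofReal (Real.exp (logRatio m v z))) := by
  have hsq : (⟨√(v : ℝ) ^ 2, sq_nonneg _⟩ : ℝ≥0) = v := by
    ext; simp
  have h1 : isoGaussian m v =
      (Measure.pi fun i => gaussianReal (m i) v).map (WithLp.toLp 2) := by
    have h2 : ∀ i, gaussianReal (m i) v = (gaussianReal 0 1).map (fun x => m i + √(v : ℝ) * x) := by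
      intro i
      have : (fun x => m i + √(v : ℝ) * x) = (fun x => m i + x) ∘ (fun x => √(v : ℝ) * x) := rfl
      rw [this, ← Measure.map_map (by fun_prop) (by fun_prop), gaussianReal_map_const_mul,
        gaussianReal_map_const_add]
      congr 1
      · simp
      · rw [mul_one]; exact hsq.symm
    simp_rw [h2]
    rw [← Measure.pi_map_pi (fun i => by fun_prop), isoGaussian_eq_map, ← map_pi_eq_stdGaussian,
      Measure.map_map (by fun_prop) (by fun_prop), Measure.map_map (by fun_prop) (by fun_prop)]
    rfl
  have h3 : (Measure.pi fun i => gaussianReal (m i) v) =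
      (Measure.pi fun _ : Fin n => gaussianReal 0 1).withDensity
        (fun x => ENNReal.ofReal (Real.exp (logRatio m v (WithLp.toLp 2 x)))) := by
    have : ∀ i, SigmaFinite ((gaussianReal 0 1).withDensity (fun x => ENNReal.ofReal
      (Real.exp (-(Real.log v) / 2 - (x - m i) ^ 2 / (2 * v) + x ^ 2 / 2)))) := fun i => by
      rw [← gaussianReal_eq_withDensity_gaussianReal_zero_one _ hv]; infer_instance
    simp_rw [gaussianReal_eq_withDensity_gaussianReal_zero_one _ hv]
    rw [Measure.pi_withDensity _ _ (fun i => by fun_prop)]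
    congr 1
    funext x
    rw [← ENNReal.ofReal_prod_of_nonneg (fun i _ => (Real.exp_pos _).le), ← Real.exp_sum]
    congr 2
    simp only [logRatio, EuclideanSpace.real_norm_sq_eq, Finset.sum_add_distrib,
      Finset.sum_sub_distrib, Finset.sum_div]
    simp
    ring
  have hm : Measurable fun z : E n => ENNReal.ofReal (Real.exp (logRatio m v z)) :=
    (Real.measurable_exp.comp (measurable_logRatio m v)).ennreal_ofReal
  rw [h1, h3, ← map_pi_eq_stdGaussian]
  ext s hs
  rw [Measure.map_apply (by fun_prop) hs,
    withDensity_apply _ ((WithLp.measurable_toLp 2 _) hs), withDensity_apply _ hs,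
    setLIntegral_map hs hm (by fun_prop)]

theorem integrable_norm_sq_stdGaussian :
    Integrable (fun w : E n => ‖w‖ ^ 2) (stdGaussian (E n)) :=
  (IsGaussian.memLp_two_id (μ := stdGaussian (E n))).integrable_norm_pow (by norm_num)

theorem integral_norm_sq_stdGaussian : ∫ w : E n, ‖w‖ ^ 2 ∂stdGaussian (E n) = n := by
  have h (i : Fin n) : ∫ w : E n, w i ^ 2 ∂stdGaussian (E n) = 1 := by
    have h1 := variance_eval_multivariateGaussian (μ := (0 : E n))
      (S := (1 : Matrix (Fin n) (Fin n) ℝ)) Matrix.PosSemidef.one i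
    rw [multivariateGaussian_zero_one] at h1
    rw [variance_of_integral_eq_zero] at h1
    · simpa using h1
    · fun_prop
    · simpa using integral_strongDual_stdGaussian (E := E n) (EuclideanSpace.proj i)
  have hi (i : Fin n) : Integrable (fun w : E n => w i ^ 2) (stdGaussian (E n)) := by
    refine integrable_norm_sq_stdGaussian.mono' (by fun_prop) (.of_forall fun w => ?_)
    rw [Real.norm_of_nonneg (sq_nonneg _), ← sq_abs, ← Real.norm_eq_abs]
    gcongr
    exact PiLp.norm_apply_le w i
  simp_rw [EuclideanSpace.real_norm_sq_eq]
  rw [integral_finsetSum _ fun i _ => hi i]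
  simp [h]

/-- The divergence of `N(m, v I)` from the standard Gaussian. -/
theorem klDiv_isoGaussian (m : E n) {v : ℝ≥0} (hv : v ≠ 0) :
    klDiv (isoGaussian m v) (stdGaussian (E n)) =
      ENNReal.ofReal ((n * v + ‖m‖ ^ 2 - n - n * Real.log v) / 2) := by
  have hv' : (0 : ℝ) < v := by positivity
  have hm : Measurable fun z : E n => ENNReal.ofReal (Real.exp (logRatio m v z)) :=
    (Real.measurable_exp.comp (measurable_logRatio m v)).ennreal_ofReal
  have hac : isoGaussian m v ≪ stdGaussian (E n) := by
    rw [isoGaussian_eq_withDensity m hv]; exact withDensity_absolutelyContinuous _ _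
  have hllr : llr (isoGaussian m v) (stdGaussian (E n)) =ᵐ[isoGaussian m v] logRatio m v := by
    refine hac.ae_le ?_
    have := Measure.rnDeriv_withDensity (stdGaussian (E n)) hm
    rw [← isoGaussian_eq_withDensity m hv] at this
    filter_upwards [this] with z hz
    rw [llr, hz, ENNReal.toReal_ofReal (Real.exp_pos _).le, Real.log_exp]
  have hcomp (w : E n) : logRatio m v (m + √(v : ℝ) • w) =
      (-(n * Real.log v) / 2 + ‖m‖ ^ 2 / 2) + (√(v : ℝ) * inner ℝ m w +
        (v - 1) / 2 * ‖w‖ ^ 2) := by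
    rw [logRatio, norm_add_sq_real, add_sub_cancel_left, norm_smul, inner_smul_right, mul_pow,
      Real.norm_of_nonneg (Real.sqrt_nonneg _), Real.sq_sqrt hv'.le]
    field_simp
    ring
  have hin : Integrable (fun w : E n => inner ℝ m w) (stdGaussian (E n)) :=
    (innerSL ℝ m).integrable_comp IsGaussian.integrable_id
  have hint1 : Integrable (fun w : E n => √(v : ℝ) * inner ℝ m w + (v - 1) / 2 * ‖w‖ ^ 2)
      (stdGaussian (E n)) :=
    (hin.const_mul _).add (integrable_norm_sq_stdGaussian.const_mul _)
  have hint : Integrable (logRatio m v) (isoGaussian m v) := by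
    rw [isoGaussian_eq_map, integrable_map_measure
      (measurable_logRatio m v).aestronglyMeasurable (measurable_add_smul _ _).aemeasurable]
    refine ((integrable_const (-(n * Real.log v) / 2 + ‖m‖ ^ 2 / 2)).add hint1).congr
      (.of_forall fun w => ?_)
    exact (hcomp w).symm
  have hval : ∫ z, logRatio m v z ∂isoGaussian m v =
      (n * v + ‖m‖ ^ 2 - n - n * Real.log v) / 2 := by
    rw [isoGaussian_eq_map, integral_map (measurable_add_smul _ _).aemeasurable
      (measurable_logRatio m v).aestronglyMeasurable]
    simp_rw [hcomp]
    rw [integral_add (integrable_const _) hint1,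
      integral_add (hin.const_mul _) (integrable_norm_sq_stdGaussian.const_mul _),
      integral_const_mul, integral_const_mul, integral_norm_sq_stdGaussian]
    have : ∫ w : E n, inner ℝ m w ∂stdGaussian (E n) = 0 :=
      integral_strongDual_stdGaussian (innerSL ℝ m)
    rw [this]
    simp
    ring
  rw [klDiv_of_ac_of_integrable hac (hint.congr hllr.symm), integral_congr_ae hllr, hval]
  simp

/-! ### The objective in closed form -/

/-- The positive part of the integrand is at most that of `c`, so `∞ - ∞` never occurs. Both the
inner and the outer expectation of the objective have this shape. -/
theorem expect_coe_sub_coe_ennreal {Ω : Type} [MeasurableSpace Ω] (P : Measure Ω)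
    [IsProbabilityMeasure P] (c : ℝ) {H : Ω → ℝ≥0∞} (hH : Measurable H) :
    expect P (fun ω => (c : EReal) - (H ω : EReal)) = (c : EReal) - ((∫⁻ ω, H ω ∂P : ℝ≥0∞) : EReal) := by
  have hpos (ω : Ω) : ((c : EReal) - (H ω : EReal)).toENNReal = ENNReal.ofReal c - H ω := by
    rw [EReal.toENNReal_sub (EReal.coe_ennreal_nonneg _)]; simp
  have hneg (ω : Ω) : (-((c : EReal) - (H ω : EReal))).toENNReal =
      (H ω + ENNReal.ofReal (-c)) - ENNReal.ofReal c := by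
    rw [EReal.neg_sub (by simp) (by simp), add_comm, ← sub_eq_add_neg]
    rcases le_total 0 c with hc | hc
    · rw [EReal.toENNReal_sub (by exact_mod_cast hc)]; simp [ENNReal.ofReal_of_nonpos (neg_nonpos.2 hc)]
    · rw [sub_eq_add_neg, ← EReal.coe_neg, EReal.toENNReal_add (EReal.coe_ennreal_nonneg _)
        (by exact_mod_cast neg_nonneg.2 hc)]
      simp [ENNReal.ofReal_of_nonpos hc]
  -- The identity between positive and negative parts, arranged as an equality of sums so that it
  -- can be integrated even when `H` has infinite integral.
  have hsum (ω : Ω) : (ENNReal.ofReal c - H ω) + (H ω + ENNReal.ofReal (-c)) =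
      ((H ω + ENNReal.ofReal (-c)) - ENNReal.ofReal c) + ENNReal.ofReal c := by
    rcases le_total 0 c with hc | hc
    · rw [ENNReal.ofReal_of_nonpos (neg_nonpos.2 hc), add_zero, tsub_add_eq_max, tsub_add_eq_max,
        max_comm]
    · simp [ENNReal.ofReal_of_nonpos hc]
  have hint : ∫⁻ ω, (ENNReal.ofReal c - H ω) ∂P + (∫⁻ ω, H ω ∂P + ENNReal.ofReal (-c)) =
      ∫⁻ ω, ((H ω + ENNReal.ofReal (-c)) - ENNReal.ofReal c) ∂P + ENNReal.ofReal c := by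
    have := lintegral_congr (μ := P) hsum
    rw [lintegral_add_left (by fun_prop), lintegral_add_left (by fun_prop),
      lintegral_add_right _ (by fun_prop)] at this
    simpa using this
  have hfin : ∫⁻ ω, (ENNReal.ofReal c - H ω) ∂P ≠ ∞ := by
    refine ne_top_of_le_ne_top (b := ENNReal.ofReal c) ENNReal.ofReal_ne_top ?_
    calc ∫⁻ ω, (ENNReal.ofReal c - H ω) ∂P ≤ ∫⁻ _, ENNReal.ofReal c ∂P :=
          lintegral_mono fun ω => tsub_le_self
      _ = ENNReal.ofReal c := by simp
  simp only [expect, hpos, hneg]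
  generalize ∫⁻ ω, (ENNReal.ofReal c - H ω) ∂P = a at *
  generalize ∫⁻ ω, ((H ω + ENNReal.ofReal (-c)) - ENNReal.ofReal c) ∂P = b at *
  generalize ∫⁻ ω, H ω ∂P = h at *
  lift a to ℝ≥0 using hfin
  by_cases hh : h = ∞
  · have hb : b = ∞ := by
      by_contra hb
      rw [hh] at hint
      simp only [top_add, add_top] at hint
      exact ENNReal.add_ne_top.2 ⟨hb, ENNReal.ofReal_ne_top⟩ hint.symm
    simp [hh, hb]
  · have hb : b ≠ ∞ := fun hb => by
      rw [hb, top_add] at hint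
      exact ENNReal.add_ne_top.2 ⟨ENNReal.coe_ne_top,
        ENNReal.add_ne_top.2 ⟨hh, ENNReal.ofReal_ne_top⟩⟩ hint
    lift h to ℝ≥0 using hh
    lift b to ℝ≥0 using hb
    have h1 := congrArg ENNReal.toReal hint
    rw [ENNReal.toReal_add (by simp) (by simp), ENNReal.toReal_add (by simp) (by simp),
      ENNReal.toReal_add (by simp) (by simp), ENNReal.toReal_ofReal', ENNReal.toReal_ofReal'] at h1
    simp only [ENNReal.coe_toReal] at h1
    have h2 : max c 0 - max (-c) 0 = c := by
      rcases le_total 0 c with hc | hc <;> simp [hc]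
    have h3 : (a : ℝ) - b = c - h := by linarith
    change ((a : ℝ) : EReal) - ((b : ℝ) : EReal) = (c : EReal) - ((h : ℝ) : EReal)
    rw [← EReal.coe_sub, ← EReal.coe_sub, h3]

variable {D d : ℕ}

/-- The mean squared error of the reconstruction of the data point `x`. -/
noncomputable def Params.reconErrorAt (p : Params D d) (x : E D) : ℝ≥0∞ :=
  ∫⁻ z, ‖x - p.decMean z‖ₑ ^ 2 ∂p.encoder x

/-- The mean squared reconstruction error. -/
noncomputable def Params.reconError (μ : Measure (E D)) (p : Params D d) : ℝ≥0∞ :=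
  ∫⁻ x, p.reconErrorAt x ∂μ

/-- The mean divergence of the encoder from the prior, for a positive encoder variance. -/
noncomputable def Params.meanDiv (μ : Measure (E D)) (p : Params D d) : ℝ :=
  (d * p.encVar + ∫ x, ‖p.encMean x‖ ^ 2 ∂μ - d - d * Real.log p.encVar) / 2

theorem Params.continuous_encMean (p : Params D d) : Continuous p.encMean := by
  obtain ⟨K, hK⟩ := p.lipschitz_encMean
  exact hK.continuous

@[fun_prop]
theorem Params.measurable_encMean (p : Params D d) : Measurable p.encMean :=
  p.continuous_encMean.measurable

instance (p : Params D d) (x : E D) : IsProbabilityMeasure (p.encoder x) := by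
  rw [Params.encoder]; infer_instance

theorem Params.lintegral_encoder (p : Params D d) (x : E D) {F : E d → ℝ≥0∞} (hF : Measurable F) :
    ∫⁻ z, F z ∂p.encoder x =
      ∫⁻ w, F (p.encMean x + √(p.encVar : ℝ) • w) ∂stdGaussian (E d) := by
  rw [Params.encoder, isoGaussian_eq_map, lintegral_map hF (measurable_add_smul _ _)]

theorem Params.measurable_reconErrorAt (p : Params D d) : Measurable p.reconErrorAt := by
  have hg := p.measurable_decMean
  have h : p.reconErrorAt = fun x => ∫⁻ w, ‖x - p.decMean (p.encMean x + √(p.encVar : ℝ) • w)‖ₑ ^ 2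
      ∂stdGaussian (E d) :=
    funext fun x => p.lintegral_encoder x (by fun_prop)
  rw [h]
  exact Measurable.lintegral_prod_right (by fun_prop)

/-- A Lipschitz map grows at most linearly, so the finite second moment of the data passes to the
encoder mean. -/
theorem Params.integrable_norm_sq_encMean (p : Params D d) (μ : Measure (E D))
    [IsProbabilityMeasure μ] (hcov : MemLp (fun x : E D => x) 2 μ) :
    Integrable (fun x => ‖p.encMean x‖ ^ 2) μ := by
  obtain ⟨K, hK⟩ := p.lipschitz_encMean
  have h : MemLp p.encMean 2 μ := by
    refine MemLp.of_le ((hcov.norm.const_mul K).add (memLp_const ‖p.encMean 0‖))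
      p.continuous_encMean.aestronglyMeasurable (.of_forall fun x => ?_)
    have h1 := hK.dist_le_mul x 0
    rw [dist_eq_norm, dist_zero_right] at h1
    have h2 := norm_le_norm_sub_add (p.encMean x) (p.encMean 0)
    refine le_trans ?_ (le_abs_self _)
    change _ ≤ K * ‖x‖ + ‖p.encMean 0‖
    linarith
  exact h.integrable_norm_pow (by norm_num)

theorem gaussian_div_nonneg (n : ℕ) {v : ℝ} (hv : 0 < v) {a : ℝ} (ha : 0 ≤ a) :
    0 ≤ (n * v + a - n - n * Real.log v) / 2 := by
  have := mul_le_mul_of_nonneg_left (Real.log_le_sub_one_of_pos hv) (Nat.cast_nonneg (α := ℝ) n)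
  nlinarith

theorem Params.meanDiv_nonneg (μ : Measure (E D)) (p : Params D d) (hv : p.encVar ≠ 0) :
    0 ≤ p.meanDiv μ :=
  gaussian_div_nonneg d (NNReal.coe_pos.2 (pos_iff_ne_zero.2 hv))
    (integral_nonneg fun _ => sq_nonneg _)

theorem Params.lintegral_klDiv (μ : Measure (E D)) [IsProbabilityMeasure μ]
    (hcov : MemLp (fun x : E D => x) 2 μ) (p : Params D d) (hv : p.encVar ≠ 0) :
    ∫⁻ x, klDiv (p.encoder x) (stdGaussian (E d)) ∂μ = ENNReal.ofReal (p.meanDiv μ) := by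
  have hi := p.integrable_norm_sq_encMean μ hcov
  have hi2 : Integrable (fun x => (d * (p.encVar : ℝ) + ‖p.encMean x‖ ^ 2 - d
      - d * Real.log p.encVar) / 2) μ :=
    ((((integrable_const _).add hi).sub (integrable_const _)).sub (integrable_const _)).div_const 2
  simp_rw [Params.encoder, klDiv_isoGaussian _ hv]
  rw [← ofReal_integral_eq_lintegral_ofReal hi2 (.of_forall fun x =>
    gaussian_div_nonneg d (NNReal.coe_pos.2 (pos_iff_ne_zero.2 hv)) (sq_nonneg _)), Params.meanDiv,
    integral_div]
  congr 2
  have h1 : ∀ x, d * (p.encVar : ℝ) + ‖p.encMean x‖ ^ 2 - d - d * Real.log p.encVar =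
      ‖p.encMean x‖ ^ 2 + (d * (p.encVar : ℝ) - d - d * Real.log p.encVar) := fun x => by ring
  simp_rw [h1]
  rw [integral_add hi (integrable_const _)]
  simp
  ring

theorem Params.log_decoderPDF (p : Params D d) (hs : 0 < p.decVar) (z : E d) (x : E D) :
    Real.log (p.decoderPDF z x) =
      -(D * Real.log (2 * Real.pi * p.decVar) / 2) - ‖x - p.decMean z‖ ^ 2 / (2 * p.decVar) := by
  have : (0 : ℝ) < 2 * Real.pi * p.decVar := by positivity
  rw [Params.decoderPDF, isoGaussianPDF, Real.log_mul (by positivity) (by positivity), Real.log_exp,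
    Real.log_rpow this]
  ring

/-- All losses are gathered in one `ℝ≥0∞` term, so an infinite reconstruction error is allowed. The
divergence is finite because the encoder variance is positive. -/
theorem objective_eq (μ : Measure (E D)) [IsProbabilityMeasure μ]
    (hcov : MemLp (fun x : E D => x) 2 μ) {B β : ℝ} (hβ : 0 ≤ β) (hβB : β < B) (p : Params D d)
    (hs : 0 < p.decVar) (hv : p.encVar ≠ 0) :
    objective μ B β p =
      (((B - β) * -(D * Real.log (2 * Real.pi * p.decVar) / 2) : ℝ) : EReal) -
        ((ENNReal.ofReal ((B - β) / (2 * p.decVar)) * p.reconError μ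
          + ENNReal.ofReal (β * p.meanDiv μ) : ℝ≥0∞) : EReal) := by
  have hg := p.measurable_decMean
  have hs' : (0 : ℝ) < p.decVar := hs
  set c : ℝ := -(D * Real.log (2 * Real.pi * p.decVar) / 2) with hc
  have hin (x : E D) : expect (p.encoder x) (fun z => ((Real.log (p.decoderPDF z x) : ℝ) : EReal)) =
      (c : EReal) - ((ENNReal.ofReal (1 / (2 * p.decVar)) * p.reconErrorAt x : ℝ≥0∞) : EReal) := by
    have h1 (z : E d) : ((Real.log (p.decoderPDF z x) : ℝ) : EReal) =
        (c : EReal) - ((ENNReal.ofReal (1 / (2 * p.decVar)) * ‖x - p.decMean z‖ₑ ^ 2 : ℝ≥0∞)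
          : EReal) := by
      rw [p.log_decoderPDF hs, EReal.coe_sub, ← ofReal_norm, ← ENNReal.ofReal_pow (norm_nonneg _),
        ← ENNReal.ofReal_mul (by positivity), EReal.coe_ennreal_ofReal,
        max_eq_left (by positivity)]
      congr 2
      ring
    simp_rw [h1]
    rw [expect_coe_sub_coe_ennreal _ _ (by fun_prop), lintegral_const_mul _ (by fun_prop)]
    rfl
  have hkl (x : E D) : klDiv (p.encoder x) (stdGaussian (E d)) ≠ ∞ := by
    rw [Params.encoder, klDiv_isoGaussian _ hv]; exact ENNReal.ofReal_ne_top
  have hklm : Measurable fun x => klDiv (p.encoder x) (stdGaussian (E d)) := by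
    simp_rw [Params.encoder, klDiv_isoGaussian _ hv]
    fun_prop
  have hout (x : E D) : ((B - β : ℝ) : EReal) *
        expect (p.encoder x) (fun z => ((Real.log (p.decoderPDF z x) : ℝ) : EReal))
      - ((β : ℝ) : EReal) * ((klDiv (p.encoder x) (stdGaussian (E d)) : ℝ≥0∞) : EReal) =
      (((B - β) * c : ℝ) : EReal) - ((ENNReal.ofReal ((B - β) / (2 * p.decVar)) * p.reconErrorAt x
        + ENNReal.ofReal β * klDiv (p.encoder x) (stdGaussian (E d)) : ℝ≥0∞) : EReal) := by
    rw [hin]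
    have hk := hkl x
    generalize klDiv (p.encoder x) (stdGaussian (E d)) = k at *
    generalize p.reconErrorAt x = r
    lift k to ℝ≥0 using hk
    by_cases hr : r = ∞
    · have h1 : ENNReal.ofReal (1 / (2 * p.decVar)) * r = ∞ := by
        rw [hr]; exact ENNReal.mul_top (by simp [hs])
      have h2 : ENNReal.ofReal ((B - β) / (2 * p.decVar)) * r = ∞ := by
        rw [hr]; exact ENNReal.mul_top (ENNReal.ofReal_pos.2
          (div_pos (sub_pos.2 hβB) (by positivity))).ne'
      rw [h1, h2, top_add, EReal.coe_ennreal_top, EReal.sub_top,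
        EReal.coe_mul_bot_of_pos (sub_pos.2 hβB), EReal.sub_top, EReal.bot_sub]
    · lift r to ℝ≥0 using hr
      have h1 : ENNReal.ofReal (1 / (2 * p.decVar)) * r =
          ENNReal.ofReal (1 / (2 * p.decVar) * r) := by
        rw [ENNReal.ofReal_mul (by positivity)]; simp
      have h2 : ENNReal.ofReal ((B - β) / (2 * p.decVar)) * r + ENNReal.ofReal β * k =
          ENNReal.ofReal ((B - β) / (2 * p.decVar) * r + β * k) := by
        have : 0 ≤ (B - β) / (2 * p.decVar) := div_nonneg (sub_pos.2 hβB).le (by positivity)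
        rw [ENNReal.ofReal_add (by positivity) (by positivity), ENNReal.ofReal_mul this,
          ENNReal.ofReal_mul hβ]
        simp
      have : 0 ≤ (B - β) / (2 * p.decVar) := div_nonneg (sub_pos.2 hβB).le (by positivity)
      rw [h1, h2, EReal.coe_ennreal_ofReal, EReal.coe_ennreal_ofReal, max_eq_left (by positivity),
        max_eq_left (by positivity)]
      have h3 : (((k : ℝ≥0) : ℝ≥0∞) : EReal) = ((k : ℝ) : EReal) := rfl
      rw [h3, ← EReal.coe_sub, ← EReal.coe_mul, ← EReal.coe_mul, ← EReal.coe_sub, ← EReal.coe_sub]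
      congr 1
      ring
  rw [objective]
  simp_rw [hout]
  have hm := p.measurable_reconErrorAt
  rw [expect_coe_sub_coe_ennreal _ _ (by fun_prop), lintegral_add_left (by fun_prop),
    lintegral_const_mul _ hm, lintegral_const_mul _ hklm, p.lintegral_klDiv μ hcov hv,
    ENNReal.ofReal_mul hβ]
  rfl

end BetaVAE

/-! ### Lower bound on the reconstruction error -/

/-- A probability measure that is not a point mass has two distinct points in its support. -/
theorem MeasureTheory.Measure.exists_ne_mem_support {X : Type*} [TopologicalSpace X]
    [HereditarilyLindelofSpace X] [MeasurableSpace X] (μ : Measure X) [IsProbabilityMeasure μ]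
    (hnd : ∀ a, μ ≠ Measure.dirac a) : ∃ u ∈ μ.support, ∃ v ∈ μ.support, u ≠ v := by
  by_contra! h
  obtain ⟨a, ha⟩ := Measure.nonempty_support (IsProbabilityMeasure.ne_zero μ)
  have hae : (id : X → X) =ᵐ[μ] fun _ => a := by
    filter_upwards [Measure.support_mem_ae (μ := μ)] with x hx using h x hx a ha
  refine hnd a ?_
  rw [← Measure.map_id (μ := μ), Measure.map_congr hae, Measure.map_const]
  simp

namespace BetaVAE

variable {D d : ℕ}

/-- If `μ` is not a point mass, then no constant approximates the identity well on a set of nearly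
full measure. -/
theorem exists_le_setLIntegral_enorm_sub_sq (μ : Measure (E D)) [IsProbabilityMeasure μ]
    (hnd : ∀ a, μ ≠ Measure.dirac a) :
    ∃ δ : ℝ≥0∞, 0 < δ ∧ ∃ c : ℝ≥0∞, 0 < c ∧ ∀ A : Set (E D), μ Aᶜ ≤ δ → ∀ a : E D,
      c ≤ ∫⁻ x in A, ‖x - a‖ₑ ^ 2 ∂μ := by
  obtain ⟨u, hu, v, hv, huv⟩ := μ.exists_ne_mem_support hnd
  -- Every `a` is at distance at least `3r/2` from `u` or from `v`, hence at least `r/2` from the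
  -- whole `r`-ball around that point.
  obtain ⟨r, hr⟩ : ∃ r, dist u v = 3 * r := ⟨dist u v / 3, by ring⟩
  have hr0 : 0 < r := by have := dist_pos.2 huv; linarith
  have hball {y : E D} (hy : y ∈ μ.support) : 0 < μ (Metric.ball y r) :=
    (Measure.mem_support_iff_forall y).1 hy _ (Metric.ball_mem_nhds y hr0)
  -- Half the smaller mass: after removal of `Aᶜ`, each ball keeps mass at least `δ`.
  set δ := min (μ (Metric.ball u r)) (μ (Metric.ball v r)) / 2 with hδ
  have hδ0 : 0 < δ := ENNReal.half_pos (lt_min (hball hu) (hball hv)).ne'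
  have hδt : δ ≠ ∞ := ne_top_of_le_ne_top (measure_ne_top μ (Metric.ball u r))
    (ENNReal.half_le_self.trans (min_le_left _ _))
  refine ⟨δ, hδ0, ENNReal.ofReal (r / 2) ^ 2 * δ, ENNReal.mul_pos
    (pow_ne_zero _ (ENNReal.ofReal_pos.2 (by positivity)).ne') hδ0.ne', fun A hA a => ?_⟩
  have key (y : E D) (hy : 2 * δ ≤ μ (Metric.ball y r)) (hay : 3 * r / 2 ≤ dist a y) :
      ENNReal.ofReal (r / 2) ^ 2 * δ ≤ ∫⁻ x in A, ‖x - a‖ₑ ^ 2 ∂μ := by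
    have h1 : δ ≤ μ.restrict A (Metric.ball y r) := by
      rw [Measure.restrict_apply Metric.isOpen_ball.measurableSet]
      refine (ENNReal.add_le_add_iff_right hδt).1 ?_
      calc δ + δ = 2 * δ := (two_mul δ).symm
        _ ≤ μ (Metric.ball y r) := hy
        _ ≤ μ (Metric.ball y r ∩ A ∪ Aᶜ) := measure_mono fun x hx => by
            by_cases hxA : x ∈ A
            · exact Or.inl ⟨hx, hxA⟩
            · exact Or.inr hxA
        _ ≤ μ (Metric.ball y r ∩ A) + δ := (measure_union_le _ _).trans (by gcongr)
    calc ENNReal.ofReal (r / 2) ^ 2 * δ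
        ≤ ENNReal.ofReal (r / 2) ^ 2 * μ.restrict A (Metric.ball y r) := by gcongr
      _ = ∫⁻ _ in Metric.ball y r, ENNReal.ofReal (r / 2) ^ 2 ∂μ.restrict A := by simp
      _ ≤ ∫⁻ x in Metric.ball y r, ‖x - a‖ₑ ^ 2 ∂μ.restrict A := by
          refine setLIntegral_mono' Metric.isOpen_ball.measurableSet fun x hx => ?_
          rw [← ofReal_norm, ← dist_eq_norm]
          gcongr
          have := dist_triangle_left a y x
          rw [Metric.mem_ball] at hx
          linarith
      _ ≤ ∫⁻ x in A, ‖x - a‖ₑ ^ 2 ∂μ := setLIntegral_le_lintegral _ _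
  have h2 : 2 * δ = min (μ (Metric.ball u r)) (μ (Metric.ball v r)) :=
    ENNReal.mul_div_cancel two_ne_zero ENNReal.ofNat_ne_top
  rcases le_total (3 * r / 2) (dist a u) with h | h
  · exact key u (h2.le.trans (min_le_left _ _)) h
  · refine key v (h2.le.trans (min_le_right _ _)) ?_
    have := dist_triangle_left u v a
    linarith

theorem exists_stdGaussian_closedBall_pos (n : ℕ) :
    ∃ R : ℕ, 0 < stdGaussian (E n) (Metric.closedBall 0 R) := by
  by_contra! h
  have h1 := measure_iUnion_null fun R : ℕ => nonpos_iff_eq_zero.1 (h R)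
  rw [Metric.iUnion_closedBall_nat, measure_univ] at h1
  exact one_ne_zero h1

/-- Gaussians with bounded mean and variance in a compact subset of `(0, ∞)` dominate, on a
given ball, a fixed positive multiple of the standard Gaussian. -/
theorem exists_mul_setLIntegral_stdGaussian_le (n : ℕ) (R M V : ℝ) {ε : ℝ} (hε : 0 < ε) :
    ∃ η : ℝ≥0∞, 0 < η ∧ ∀ (m : E n) (v : ℝ≥0), ‖m‖ ≤ M → ε ≤ v → v ≤ V →
      ∀ F : E n → ℝ≥0∞, Measurable F →
        η * ∫⁻ z in Metric.closedBall 0 R, F z ∂stdGaussian (E n) ≤ ∫⁻ z, F z ∂isoGaussian m v := by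
  -- The worst case of `logRatio` on the ball, with the nonnegative term `‖z‖² / 2` dropped.
  refine ⟨ENNReal.ofReal (Real.exp (-(n * Real.log V) / 2 - (R + M) ^ 2 / (2 * ε))),
    ENNReal.ofReal_pos.2 (Real.exp_pos _), fun m v hm hεv hvV F hF => ?_⟩
  have hv0 : (0 : ℝ) < v := hε.trans_le hεv
  have hv : v ≠ 0 := (NNReal.coe_pos.1 hv0).ne'
  have hmeas : Measurable fun z : E n => ENNReal.ofReal (Real.exp (logRatio m v z)) :=
    (Real.measurable_exp.comp (measurable_logRatio m v)).ennreal_ofReal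
  rw [isoGaussian_eq_withDensity m hv, lintegral_withDensity_eq_lintegral_mul _ hmeas hF,
    ← lintegral_const_mul _ hF]
  refine (setLIntegral_mono' Metric.isClosed_closedBall.measurableSet fun z hz => ?_).trans
    (setLIntegral_le_lintegral _ _)
  rw [Pi.mul_apply]
  gcongr
  have hz' : ‖z‖ ≤ R := mem_closedBall_zero_iff.1 hz
  have h1 : ‖z - m‖ ≤ R + M := (norm_sub_le z m).trans (add_le_add hz' hm)
  have h2 : ‖z - m‖ ^ 2 / (2 * v) ≤ (R + M) ^ 2 / (2 * ε) := by gcongr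
  have h3 : n * Real.log v ≤ n * Real.log V := by gcongr
  rw [logRatio]
  nlinarith [sq_nonneg ‖z‖]

/-- If the encoder variance is bounded away from `0` and `∞` and the encoder mean is bounded on a
set of nearly full measure, then the reconstruction error is bounded away from `0`. -/
theorem exists_le_reconError (d : ℕ) (μ : Measure (E D)) [IsProbabilityMeasure μ]
    (hnd : ∀ a, μ ≠ Measure.dirac a) :
    ∃ δ : ℝ≥0∞, 0 < δ ∧ ∀ M V ε : ℝ, 0 < ε → ∃ c : ℝ≥0∞, 0 < c ∧ ∀ p : Params D d,
      ε ≤ p.encVar → p.encVar ≤ V → μ {x | M < ‖p.encMean x‖} ≤ δ → c ≤ p.reconError μ := by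
  obtain ⟨δ, hδ, c, hc, hcA⟩ := exists_le_setLIntegral_enorm_sub_sq μ hnd
  refine ⟨δ, hδ, fun M V ε hε => ?_⟩
  obtain ⟨R, hR⟩ := exists_stdGaussian_closedBall_pos d
  obtain ⟨η, hη, hle⟩ := exists_mul_setLIntegral_stdGaussian_le d R M V hε
  refine ⟨η * (c * stdGaussian (E d) (Metric.closedBall 0 R)),
    ENNReal.mul_pos hη.ne' (ENNReal.mul_pos hc.ne' hR.ne').ne', fun p h1 h2 h3 => ?_⟩
  have hg := p.measurable_decMean
  set A := {x | ‖p.encMean x‖ ≤ M} with hA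
  have hAm : MeasurableSet A := measurableSet_le (by fun_prop) measurable_const
  have hAc : Aᶜ = {x | M < ‖p.encMean x‖} := by ext; simp [hA]
  have hF : Measurable fun q : E D × E d => ‖q.1 - p.decMean q.2‖ₑ ^ 2 := by fun_prop
  -- With the encoder law replaced by one independent of `x`, Tonelli allows integrating over the
  -- data first; for fixed `z` the decoder output is then a single constant.
  calc η * (c * stdGaussian (E d) (Metric.closedBall 0 R))
      = η * ∫⁻ _ in Metric.closedBall 0 R, c ∂stdGaussian (E d) := by simp
    _ ≤ η * ∫⁻ z in Metric.closedBall 0 R, ∫⁻ x in A, ‖x - p.decMean z‖ₑ ^ 2 ∂μ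
          ∂stdGaussian (E d) := by
        gcongr with z
        exact hcA A (hAc ▸ h3) _
    _ = η * ∫⁻ x in A, ∫⁻ z in Metric.closedBall 0 R, ‖x - p.decMean z‖ₑ ^ 2
          ∂stdGaussian (E d) ∂μ := by rw [lintegral_lintegral_swap hF.aemeasurable.prod_swap]
    _ = ∫⁻ x in A, η * ∫⁻ z in Metric.closedBall 0 R, ‖x - p.decMean z‖ₑ ^ 2
          ∂stdGaussian (E d) ∂μ := by
        rw [lintegral_const_mul _ (Measurable.lintegral_prod_right hF)]
    _ ≤ ∫⁻ x in A, p.reconErrorAt x ∂μ :=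
        setLIntegral_mono' hAm fun x hx => hle _ _ hx h1 h2 _ (by fun_prop)
    _ ≤ p.reconError μ := setLIntegral_le_lintegral _ _

/-! ### Encoders with small reconstruction error -/

/-- Every finite-valued measurable map factors as `c ∘ k` through `ℕ`, with `c` bounded. -/
theorem exists_comp_nat_of_simpleFunc {X Y : Type*} [MeasurableSpace X] [NormedAddCommGroup Y]
    (φ : SimpleFunc X Y) :
    ∃ (k : SimpleFunc X ℕ) (c : ℕ → Y) (C : ℝ), 0 < C ∧ (∀ j, ‖c j‖ ≤ C) ∧
      ∀ x, c (k x) = φ x := by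
  classical
  -- The default value `0` keeps `c` bounded on indices outside the list; the `+ 1` keeps `C`
  -- positive even when `φ = 0`.
  refine ⟨φ.map fun y => φ.range.toList.idxOf y, fun j => φ.range.toList.getD j 0,
    ∑ y ∈ φ.range, ‖y‖ + 1, by positivity, fun j => ?_, fun x => ?_⟩
  · beta_reduce
    by_cases hj : j < φ.range.toList.length
    · rw [List.getD_eq_getElem _ _ hj]
      have hmem := Finset.mem_toList.1 (List.getElem_mem hj)
      have := Finset.single_le_sum (f := fun y : Y => ‖y‖) (fun y _ => norm_nonneg y) hmem
      linarith
    · rw [List.getD_eq_default _ _ (not_lt.1 hj), norm_zero]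
      positivity
  · have hmem : φ x ∈ φ.range.toList := Finset.mem_toList.2 (φ.mem_range_self x)
    beta_reduce
    rw [SimpleFunc.map_apply, List.getD_eq_getElem _ _ (List.idxOf_lt_length_of_mem hmem)]
    exact List.getElem_idxOf _

theorem lintegral_norm_sq_stdGaussian (n : ℕ) :
    ∫⁻ w : E n, ENNReal.ofReal (‖w‖ ^ 2) ∂stdGaussian (E n) = n := by
  rw [← ofReal_integral_eq_lintegral_ofReal integrable_norm_sq_stdGaussian
    (.of_forall fun _ => sq_nonneg _), integral_norm_sq_stdGaussian, ENNReal.ofReal_natCast]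

/-- Decoding a noisy index by rounding: the error is controlled by the quantization error, the
error in the index, and the noise. -/
theorem norm_sub_round_sq_le {Y : Type*} [NormedAddCommGroup Y] {c : ℕ → Y} {C : ℝ}
    (hc : ∀ j, ‖c j‖ ≤ C) (x : Y) (k : ℕ) (y s : ℝ) :
    ‖x - c ⌊y + s + 1 / 2⌋₊‖ ^ 2 ≤
      2 * ‖x - c k‖ ^ 2 + (32 * C ^ 2 * |k - y| + 128 * C ^ 2 * s ^ 2) := by
  by_cases h : |y + s - k| < 1 / 2
  · have hk : ⌊y + s + 1 / 2⌋₊ = k := by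
      rw [abs_lt] at h
      rw [Nat.floor_eq_iff (by have := Nat.cast_nonneg (α := ℝ) k; linarith)]
      constructor <;> linarith
    rw [hk]
    have : 0 ≤ 32 * C ^ 2 * |k - y| + 128 * C ^ 2 * s ^ 2 := by positivity
    nlinarith [sq_nonneg ‖x - c k‖]
  · set j := ⌊y + s + 1 / 2⌋₊
    have h1 : ‖x - c j‖ ≤ ‖x - c k‖ + ‖c k - c j‖ := norm_sub_le_norm_sub_add_norm_sub _ _ _
    have h2 : ‖c k - c j‖ ≤ 2 * C := by
      have := norm_sub_le (c k) (c j)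
      linarith [hc k, hc j]
    -- When rounding may fail, `|k - y| + |s| ≥ 1/2`, so one of the two is at least `1/4`.
    -- Multiplying by `2 (2C)² = 8C²` gives the constants `32` and `128`.
    have h3 : 1 ≤ 4 * |k - y| + 16 * s ^ 2 := by
      have h4 : |y + s - k| ≤ |k - y| + |s| := by
        rw [abs_sub_comm (k : ℝ) y]
        calc |y + s - k| = |(y - k) + s| := by ring_nf
          _ ≤ _ := abs_add_le _ _
      rw [not_lt] at h
      rw [← sq_abs s]
      by_cases h5 : 1 / 4 ≤ |s|
      · nlinarith [abs_nonneg ((k : ℝ) - y)]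
      · nlinarith [sq_nonneg |s|]
    have h5 : ‖x - c j‖ ^ 2 ≤ 2 * ‖x - c k‖ ^ 2 + 2 * (2 * C) ^ 2 := by
      have h6 : ‖c k - c j‖ ^ 2 ≤ (2 * C) ^ 2 := by gcongr
      have h7 : ‖x - c j‖ ^ 2 ≤ (‖x - c k‖ + ‖c k - c j‖) ^ 2 := by gcongr
      nlinarith [sq_nonneg (‖x - c k‖ - ‖c k - c j‖)]
    nlinarith [mul_le_mul_of_nonneg_left h3 (sq_nonneg C)]

/-- The reconstruction error can be made arbitrarily small with a Lipschitz encoder mean and a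
positive encoder variance. -/
theorem exists_reconError_lt (hd : 1 ≤ d) (μ : Measure (E D)) [IsProbabilityMeasure μ]
    (hcov : MemLp (fun x : E D => x) 2 μ) {ε : ℝ} (hε : 0 < ε) :
    ∃ p : Params D d, p.encVar ≠ 0 ∧ p.reconError μ < ENNReal.ofReal ε := by
  -- Three errors, each allotted `ε / 4`: quantization of `x` by `φ` (doubled, hence `ε / 8`),
  -- approximation of the index by a Lipschitz `ψ`, and encoder noise.
  obtain ⟨φ, hφ, -⟩ := hcov.exists_simpleFunc_eLpNorm_sub_lt (by norm_num)
    (ENNReal.ofReal_pos.2 (Real.sqrt_pos.2 (show 0 < ε / 8 by positivity))).ne'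
  obtain ⟨k, c, C, hC, hcC, hck⟩ := exists_comp_nat_of_simpleFunc φ
  have hkm : MemLp (fun x => (k x : ℝ)) 1 μ :=
    (k.map (Nat.cast : ℕ → ℝ)).memLp_of_isFiniteMeasure 1 μ
  obtain ⟨ψ, hψ1, hψ2, hψ3⟩ := hkm.exist_eLpNorm_sub_le (by norm_num) le_rfl
    (show 0 < ε / (4 * (32 * C ^ 2)) by positivity)
  obtain ⟨K, hK⟩ := hψ2.lipschitzWith_of_hasCompactSupport hψ1 (by simp)
  have hd0 : (0 : ℝ) < d := by exact_mod_cast hd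
  set v : ℝ≥0 := Real.toNNReal (ε / (4 * (128 * C ^ 2 * d))) with hv
  have hv0 : 0 < v := Real.toNNReal_pos.2 (by positivity)
  have hvr : (v : ℝ) = ε / (4 * (128 * C ^ 2 * d)) := Real.coe_toNNReal _ (by positivity)
  let i : Fin d := ⟨0, hd⟩
  -- The index is written, up to the Lipschitz approximation, into one latent coordinate; the
  -- decoder rounds that coordinate and looks up the quantized value.
  let p : Params D d :=
    { encMean := fun x => EuclideanSpace.single i (ψ x)
      encVar := v
      decMean := fun z => c ⌊z i + 1 / 2⌋₊
      decVar := 1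
      lipschitz_encMean := ⟨K, fun x y => by
        rw [PiLp.edist_single_same]; exact hK x y⟩
      measurable_decMean := (measurable_from_nat (f := c)).comp
        (Nat.measurable_floor.comp (by fun_prop)) }
  refine ⟨p, hv0.ne', ?_⟩
  have hg := p.measurable_decMean
  have hψm : Measurable ψ := hψ2.continuous.measurable
  have hkm' : Measurable fun x => (k x : ℝ) := (k.map (Nat.cast : ℕ → ℝ)).measurable
  have hq : ∫⁻ x, ENNReal.ofReal (2 * ‖x - φ x‖ ^ 2) ∂μ ≤ ENNReal.ofReal (ε / 4) := by
    have h1 : eLpNorm ((fun x : E D => x) - ⇑φ) 2 μ ^ 2 ≤ ENNReal.ofReal (ε / 8) := by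
      rw [← Real.sq_sqrt (show 0 ≤ ε / 8 by positivity), ENNReal.ofReal_pow (Real.sqrt_nonneg _)]
      gcongr
    have h2 : eLpNorm ((fun x : E D => x) - ⇑φ) 2 μ ^ 2 = ∫⁻ x, ‖x - φ x‖ₑ ^ 2 ∂μ := by
      rw [eLpNorm_eq_lintegral_rpow_enorm_toReal (by norm_num) (by norm_num),
        ← ENNReal.rpow_natCast, ← ENNReal.rpow_mul]
      simp
    rw [h2] at h1
    have h3 (x : E D) : ENNReal.ofReal (2 * ‖x - φ x‖ ^ 2) = 2 * ‖x - φ x‖ₑ ^ 2 := by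
      rw [ENNReal.ofReal_mul zero_le_two, ENNReal.ofReal_pow (norm_nonneg _), ofReal_norm]
      simp
    simp_rw [h3]
    rw [lintegral_const_mul' _ _ (by norm_num)]
    calc 2 * ∫⁻ x, ‖x - φ x‖ₑ ^ 2 ∂μ ≤ ENNReal.ofReal 2 * ENNReal.ofReal (ε / 8) := by
          rw [ENNReal.ofReal_ofNat]; gcongr
      _ = ENNReal.ofReal (ε / 4) := by rw [← ENNReal.ofReal_mul zero_le_two]; congr 1; ring
  have hi : ∫⁻ x, ENNReal.ofReal (32 * C ^ 2 * |k x - ψ x|) ∂μ ≤ ENNReal.ofReal (ε / 4) := by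
    have hr : (0 : ℝ) ≤ 32 * C ^ 2 := by positivity
    simp_rw [ENNReal.ofReal_mul hr]
    rw [lintegral_const_mul' _ _ ENNReal.ofReal_ne_top]
    rw [eLpNorm_one_eq_lintegral_enorm] at hψ3
    calc ENNReal.ofReal (32 * C ^ 2) * ∫⁻ x, ENNReal.ofReal |k x - ψ x| ∂μ
        ≤ ENNReal.ofReal (32 * C ^ 2) * ENNReal.ofReal (ε / (4 * (32 * C ^ 2))) := by
          gcongr
          refine le_trans (le_of_eq (lintegral_congr fun x => ?_)) hψ3
          rw [Pi.sub_apply, ← ofReal_norm, Real.norm_eq_abs]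
      _ = ENNReal.ofReal (ε / 4) := by
          rw [← ENNReal.ofReal_mul hr]; congr 1; field_simp
  have hn : ∫⁻ w : E d, ENNReal.ofReal (128 * C ^ 2 * (√(v : ℝ) * w i) ^ 2) ∂stdGaussian (E d) ≤
      ENNReal.ofReal (ε / 4) := by
    have hr : (0 : ℝ) ≤ 128 * C ^ 2 * v := by positivity
    calc ∫⁻ w : E d, ENNReal.ofReal (128 * C ^ 2 * (√(v : ℝ) * w i) ^ 2) ∂stdGaussian (E d)
        ≤ ∫⁻ w : E d, ENNReal.ofReal (128 * C ^ 2 * v) * ENNReal.ofReal (‖w‖ ^ 2)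
            ∂stdGaussian (E d) := by
          refine lintegral_mono fun w => ?_
          rw [← ENNReal.ofReal_mul hr, mul_pow, Real.sq_sqrt v.coe_nonneg, ← mul_assoc, ← sq_abs (w i),
            ← Real.norm_eq_abs]
          gcongr
          exact PiLp.norm_apply_le w i
      _ = ENNReal.ofReal (ε / 4) := by
          rw [lintegral_const_mul' _ _ ENNReal.ofReal_ne_top, lintegral_norm_sq_stdGaussian,
            ← ENNReal.ofReal_natCast, ← ENNReal.ofReal_mul hr, hvr]
          congr 1
          field_simp
  have hat (x : E D) : p.reconErrorAt x ≤ ENNReal.ofReal (2 * ‖x - φ x‖ ^ 2) +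
      (ENNReal.ofReal (32 * C ^ 2 * |k x - ψ x|) + ENNReal.ofReal (ε / 4)) := by
    rw [Params.reconErrorAt, p.lintegral_encoder x (by fun_prop)]
    calc ∫⁻ w, ‖x - p.decMean (p.encMean x + √(p.encVar : ℝ) • w)‖ₑ ^ 2 ∂stdGaussian (E d)
        ≤ ∫⁻ w : E d, (ENNReal.ofReal (2 * ‖x - φ x‖ ^ 2) +
            (ENNReal.ofReal (32 * C ^ 2 * |k x - ψ x|) +
              ENNReal.ofReal (128 * C ^ 2 * (√(v : ℝ) * w i) ^ 2))) ∂stdGaussian (E d) := by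
          refine lintegral_mono fun w => ?_
          rw [← ENNReal.ofReal_add (by positivity) (by positivity),
            ← ENNReal.ofReal_add (by positivity) (by positivity), ← ofReal_norm,
            ← ENNReal.ofReal_pow (norm_nonneg _), ← hck x]
          refine ENNReal.ofReal_le_ofReal ?_
          have := norm_sub_round_sq_le hcC x (k x) (ψ x) (√(v : ℝ) * w i)
          simpa [p] using this
      _ ≤ _ := by
          rw [lintegral_add_left measurable_const, lintegral_add_left measurable_const]
          simp only [lintegral_const, measure_univ, mul_one]
          gcongr
  calc p.reconError μ ≤ ∫⁻ x, (ENNReal.ofReal (2 * ‖x - φ x‖ ^ 2) +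
      (ENNReal.ofReal (32 * C ^ 2 * |k x - ψ x|) + ENNReal.ofReal (ε / 4))) ∂μ :=
        lintegral_mono hat
    _ ≤ ENNReal.ofReal (ε / 4) + (ENNReal.ofReal (ε / 4) + ENNReal.ofReal (ε / 4)) := by
        rw [lintegral_add_left, lintegral_add_left (by fun_prop)]
        · simp only [lintegral_const, measure_univ, mul_one]
          gcongr
        · have := φ.measurable
          fun_prop
    _ = ENNReal.ofReal (3 * ε / 4) := by
        rw [← ENNReal.ofReal_add (by positivity) (by positivity),
          ← ENNReal.ofReal_add (by positivity) (by positivity)]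
        congr 1
        ring
    _ < ENNReal.ofReal ε := (ENNReal.ofReal_lt_ofReal_iff hε).2 (by linarith)

/-! ### Real-valued bounds for comparing optima -/

/-- A quantitative form of `exists_le_reconError` in terms of the second moment of the encoder
mean. -/
theorem exists_ofReal_le_reconError (d : ℕ) (μ : Measure (E D)) [IsProbabilityMeasure μ]
    (hcov : MemLp (fun x : E D => x) 2 μ) (hnd : ∀ a, μ ≠ Measure.dirac a) (T V : ℝ) {ε : ℝ}
    (hε : 0 < ε) :
    ∃ c : ℝ, 0 < c ∧ ∀ p : Params D d, ε ≤ p.encVar → p.encVar ≤ V →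
      ∫ x, ‖p.encMean x‖ ^ 2 ∂μ ≤ T → ENNReal.ofReal c ≤ p.reconError μ := by
  obtain ⟨δ, hδ, h⟩ := exists_le_reconError d μ hnd
  obtain ⟨δ', hδ'0, hδ'⟩ := ENNReal.lt_iff_exists_nnreal_btwn.1 hδ
  have hδ'0 : (0 : ℝ) < δ' := by exact_mod_cast hδ'0
  -- Chosen so that Markov's inequality gives `‖encMean‖ ≥ M` mass at most `δ'`. This is possible
  -- because `δ` in `exists_le_reconError` does not depend on `M`.
  set M := √((|T| + 1) / δ') with hM
  have hM0 : 0 < M := Real.sqrt_pos.2 (by positivity)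
  obtain ⟨c, hc, hle⟩ := h M V ε hε
  obtain ⟨c', hc'0, hc'⟩ := ENNReal.lt_iff_exists_nnreal_btwn.1 hc
  refine ⟨c', by exact_mod_cast hc'0, fun p h1 h2 h3 => ?_⟩
  rw [ENNReal.ofReal_coe_nnreal]
  refine hc'.le.trans (hle p h1 h2 (le_trans ?_ hδ'.le))
  have hi := p.integrable_norm_sq_encMean μ hcov
  have hmarkov := mul_meas_ge_le_integral_of_nonneg (.of_forall fun x => sq_nonneg ‖p.encMean x‖)
    hi (M ^ 2)
  have hM2 : M ^ 2 = (|T| + 1) / δ' := Real.sq_sqrt (by positivity)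
  have h4 : μ.real {x | M ^ 2 ≤ ‖p.encMean x‖ ^ 2} ≤ δ' := by
    have h5 : (|T| + 1) / δ' * μ.real {x | M ^ 2 ≤ ‖p.encMean x‖ ^ 2} ≤ |T| + 1 := by
      rw [← hM2]
      have := le_abs_self T
      linarith
    rw [div_mul_eq_mul_div, div_le_iff₀ hδ'0] at h5
    exact le_of_mul_le_mul_left h5 (by positivity)
  calc μ {x | M < ‖p.encMean x‖} ≤ μ {x | M ^ 2 ≤ ‖p.encMean x‖ ^ 2} :=
        measure_mono fun x (hx : M < ‖p.encMean x‖) =>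
          show M ^ 2 ≤ ‖p.encMean x‖ ^ 2 from pow_le_pow_left₀ hM0.le hx.le 2
    _ = ENNReal.ofReal (μ.real {x | M ^ 2 ≤ ‖p.encMean x‖ ^ 2}) :=
        (ofReal_measureReal (measure_ne_top _ _)).symm
    _ ≤ ENNReal.ofReal δ' := ENNReal.ofReal_le_ofReal h4
    _ = δ' := ENNReal.ofReal_coe_nnreal

theorem objective_eq_coe (μ : Measure (E D)) [IsProbabilityMeasure μ]
    (hcov : MemLp (fun x : E D => x) 2 μ) {B β : ℝ} (hβ : 0 ≤ β) (hβB : β < B) (p : Params D d)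
    (hs : 0 < p.decVar) (hv : p.encVar ≠ 0) (hR : p.reconError μ ≠ ∞) :
    objective μ B β p =
      (((B - β) * -(D * Real.log (2 * Real.pi * p.decVar) / 2) -
        ((B - β) / (2 * p.decVar) * (p.reconError μ).toReal + β * p.meanDiv μ) : ℝ) : EReal) := by
  have h0 : 0 ≤ (B - β) / (2 * p.decVar) := div_nonneg (sub_pos.2 hβB).le (by positivity)
  have hK := p.meanDiv_nonneg μ hv
  have h1 : ENNReal.ofReal ((B - β) / (2 * p.decVar)) * p.reconError μ
      + ENNReal.ofReal (β * p.meanDiv μ) = ENNReal.ofReal ((B - β) / (2 * p.decVar) *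
        (p.reconError μ).toReal + β * p.meanDiv μ) := by
    rw [ENNReal.ofReal_add (by positivity) (by positivity), ENNReal.ofReal_mul h0,
      ENNReal.ofReal_toReal hR]
  rw [objective_eq μ hcov hβ hβB p hs hv, h1, EReal.coe_ennreal_ofReal,
    max_eq_left (by positivity), EReal.coe_sub]

theorem objective_eq_bot (μ : Measure (E D)) [IsProbabilityMeasure μ]
    (hcov : MemLp (fun x : E D => x) 2 μ) {B β : ℝ} (hβ : 0 ≤ β) (hβB : β < B) (p : Params D d)
    (hs : 0 < p.decVar) (hv : p.encVar ≠ 0) (hR : p.reconError μ = ∞) :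
    objective μ B β p = ⊥ := by
  have h0 : 0 < (B - β) / (2 * p.decVar) :=
    div_pos (sub_pos.2 hβB) (mul_pos two_pos (NNReal.coe_pos.2 hs))
  rw [objective_eq μ hcov hβ hβB p hs hv, hR, ENNReal.mul_top (ENNReal.ofReal_pos.2 h0).ne',
    top_add, EReal.coe_ennreal_top, EReal.sub_top]

/-- A global optimum with positive encoder variance beats every competitor with positive encoder
variance and finite reconstruction error. -/
theorem IsGlobalOptimum.le_of_encVar_ne_zero {μ : Measure (E D)} [IsProbabilityMeasure μ]
    (hcov : MemLp (fun x : E D => x) 2 μ) {B β : ℝ} (hβ : 0 ≤ β) (hβB : β < B) {S : Set ℝ≥0}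
    (hS : ∀ v ∈ S, 0 < v) {p : Params D d} (hp : IsGlobalOptimum μ B S β p) (hv : p.encVar ≠ 0)
    {q : Params D d} (hqS : q.decVar ∈ S) (hqv : q.encVar ≠ 0) (hqR : q.reconError μ ≠ ∞) :
    p.reconError μ ≠ ∞ ∧
    (B - β) * -(D * Real.log (2 * Real.pi * q.decVar) / 2) -
        ((B - β) / (2 * q.decVar) * (q.reconError μ).toReal + β * q.meanDiv μ) ≤
      (B - β) * -(D * Real.log (2 * Real.pi * p.decVar) / 2) -
        ((B - β) / (2 * p.decVar) * (p.reconError μ).toReal + β * p.meanDiv μ) := by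
  have hle := hp.2 q hqS
  rw [objective_eq_coe μ hcov hβ hβB q (hS _ hqS) hqv hqR] at hle
  have hR : p.reconError μ ≠ ∞ := fun hR => by
    rw [objective_eq_bot μ hcov hβ hβB p (hS _ hp.1) hv hR, le_bot_iff] at hle
    exact EReal.coe_ne_bot _ hle
  rw [objective_eq_coe μ hcov hβ hβB p (hS _ hp.1) hv hR, EReal.coe_le_coe_iff] at hle
  exact ⟨hR, hle⟩

/-! ### The scale of the latent space -/

/-- Rescaling of the latent space by a positive factor. -/
noncomputable def Params.rescale (p : Params D d) (c : ℝ≥0) : Params D d where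
  encMean x := c • p.encMean x
  encVar := c ^ 2 * p.encVar
  decMean z := p.decMean (c⁻¹ • z)
  decVar := p.decVar
  lipschitz_encMean := by
    obtain ⟨K, hK⟩ := p.lipschitz_encMean
    exact ⟨_, (lipschitzWith_smul (c : ℝ)).comp hK⟩
  measurable_decMean := p.measurable_decMean.comp (by fun_prop)

theorem Params.reconError_rescale (μ : Measure (E D)) (p : Params D d) {c : ℝ≥0} (hc : c ≠ 0) :
    (p.rescale c).reconError μ = p.reconError μ := by
  have hg := p.measurable_decMean
  have hg' := (p.rescale c).measurable_decMean
  refine lintegral_congr fun x => ?_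
  rw [Params.reconErrorAt, Params.reconErrorAt, Params.lintegral_encoder _ _ (by fun_prop),
    Params.lintegral_encoder _ _ (by fun_prop)]
  refine lintegral_congr fun w => ?_
  have h : c⁻¹ • ((p.rescale c).encMean x + √((p.rescale c).encVar : ℝ) • w) =
      p.encMean x + √(p.encVar : ℝ) • w := by
    have h1 : √((p.rescale c).encVar : ℝ) • w = c • (√(p.encVar : ℝ) • w) := by
      simp only [Params.rescale, NNReal.coe_mul, NNReal.coe_pow]
      rw [Real.sqrt_mul (by positivity), Real.sqrt_sq c.coe_nonneg, mul_smul, NNReal.smul_def]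
    rw [h1, Params.rescale, ← smul_add, smul_smul, inv_mul_cancel₀ hc, one_smul]
  change ‖x - p.decMean (c⁻¹ • _)‖ₑ ^ 2 = _
  rw [h]

theorem Params.meanDiv_rescale (μ : Measure (E D)) (p : Params D d) {c : ℝ≥0} (hc : c ≠ 0)
    (hv : p.encVar ≠ 0) :
    (p.rescale c).meanDiv μ = ((c : ℝ) ^ 2 * (d * p.encVar + ∫ x, ‖p.encMean x‖ ^ 2 ∂μ) - d
      - d * (Real.log ((c : ℝ) ^ 2) + Real.log p.encVar)) / 2 := by
  have hc' : (c : ℝ) ≠ 0 := NNReal.coe_ne_zero.2 hc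
  have hv' : (p.encVar : ℝ) ≠ 0 := NNReal.coe_ne_zero.2 hv
  have h : ∫ x, ‖c • p.encMean x‖ ^ 2 ∂μ = (c : ℝ) ^ 2 * ∫ x, ‖p.encMean x‖ ^ 2 ∂μ := by
    rw [← integral_const_mul]
    congr 1
    funext x
    rw [NNReal.smul_def, norm_smul, mul_pow, Real.norm_of_nonneg c.coe_nonneg]
  simp only [Params.meanDiv, Params.rescale]
  rw [h, NNReal.coe_mul, NNReal.coe_pow, Real.log_mul (pow_ne_zero _ hc') hv']
  ring

/-- At an optimal scale of the latent space, the mean squared norm of the latent variable is the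
latent dimension. -/
theorem Params.second_moment_eq_of_le_rescale (hd : 1 ≤ d) (μ : Measure (E D)) (p : Params D d)
    (hv : p.encVar ≠ 0) (h : ∀ c : ℝ≥0, c ≠ 0 → p.meanDiv μ ≤ (p.rescale c).meanDiv μ) :
    d * p.encVar + ∫ x, ‖p.encMean x‖ ^ 2 ∂μ = d := by
  have hd0 : (0 : ℝ) < d := by exact_mod_cast hd
  have hv0 : (0 : ℝ) < p.encVar := by positivity
  have hI : 0 ≤ ∫ x, ‖p.encMean x‖ ^ 2 ∂μ := integral_nonneg fun _ => sq_nonneg _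
  set T := d * (p.encVar : ℝ) + ∫ x, ‖p.encMean x‖ ^ 2 ∂μ with hT
  have hT0 : 0 < T := by positivity
  -- `c² = d / T` minimizes `c² T - d log c²`, the part of the divergence that depends on the scale.
  have hc0 : Real.toNNReal √(d / T) ≠ 0 :=
    (Real.toNNReal_pos.2 (Real.sqrt_pos.2 (by positivity))).ne'
  have h1 := h _ hc0
  rw [p.meanDiv_rescale μ hc0 hv, Real.coe_toNNReal _ (Real.sqrt_nonneg _),
    Real.sq_sqrt (by positivity), ← hT, div_mul_cancel₀ _ hT0.ne', Params.meanDiv, ← hT] at h1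
  by_contra hne
  -- The inequality is strict unless `T = d`, so any other scale could be improved.
  have h2 := Real.log_lt_sub_one_of_pos (show 0 < T / d by positivity)
    (fun h => hne ((div_eq_one_iff_eq hd0.ne').1 h))
  rw [← inv_div T d, Real.log_inv] at h1
  have h3 : d * Real.log (T / d) < T - d := by
    calc d * Real.log (T / d) < d * (T / d - 1) := by gcongr
      _ = T - d := by field_simp
  linarith

end BetaVAE

/-! ### The conclusion -/

open BetaVAE in
theorem proposition1 {D d : ℕ} (hd : 1 ≤ d)
    (μ : MeasureTheory.Measure (BetaVAE.E D)) [MeasureTheory.IsProbabilityMeasure μ]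
    (hcov : MeasureTheory.MemLp (fun x : BetaVAE.E D => x) 2 μ)
    (hnd : ∀ a : BetaVAE.E D, μ ≠ MeasureTheory.Measure.dirac a)
    (B : ℝ) (hB : 0 < B) (S : Set ℝ≥0) (hS : ∀ v ∈ S, 0 < v) :
    (∀ ε : ℝ, 0 < ε → ∃ β₀ : ℝ, 0 < β₀ ∧ ∀ β : ℝ, 0 < β → β < β₀ →
      ∀ p : BetaVAE.Params D d, BetaVAE.IsGlobalOptimum μ B S β p → (p.encVar : ℝ) < ε) ∧
    (∀ p : BetaVAE.Params D d, BetaVAE.IsGlobalOptimum μ B S 0 p → p.encVar = 0) := by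
  -- For `D = 0` the space is a single point. Positivity is needed to bound the decoder variance
  -- through `D log s`.
  have hD : (0 : ℝ) < D := by
    rcases Nat.eq_zero_or_pos D with rfl | h
    · obtain ⟨u, -, v, -, huv⟩ := μ.exists_ne_mem_support hnd
      exact absurd (Subsingleton.elim u v) huv
    · exact_mod_cast h
  refine ⟨fun ε hε => ?_, fun p hp => ?_⟩
  · rcases S.eq_empty_or_nonempty with rfl | ⟨s₀, hs₀⟩
    · exact ⟨1, one_pos, fun β _ _ p hp => absurd hp.1 (Set.notMem_empty _)⟩
    have hs₀0 : (0 : ℝ) < s₀ := hS s₀ hs₀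
    -- `T = d` and `V = 1` are the bounds that the optimal latent scale will provide.
    obtain ⟨c, hc, hlow⟩ := exists_ofReal_le_reconError d μ hcov hnd d 1 hε
    obtain ⟨q, hqv, hqR⟩ := exists_reconError_lt hd μ hcov (half_pos hc)
    have hqt : q.reconError μ ≠ ∞ := (hqR.trans ENNReal.ofReal_lt_top).ne
    have hqr : (q.reconError μ).toReal ≤ c / 2 := ENNReal.toReal_le_of_le_ofReal (by positivity) hqR.le
    have hqK := q.meanDiv_nonneg μ hqv
    set K := q.meanDiv μ with hK
    set r := (q.reconError μ).toReal with hr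
    have hr0 : 0 ≤ r := ENNReal.toReal_nonneg
    -- When `β ≤ B - β`, the loss of `q` with decoder variance `s₀` is at most `(B - β) Q`. The
    -- value `s₁` solves `D log(2πs) / 2 = Q` and so bounds the decoder variance of every optimum
    -- considered, uniformly in `β`.
    obtain ⟨Q, hQ⟩ : ∃ Q, Q = D * Real.log (2 * Real.pi * s₀) / 2 + r / (2 * s₀) + K := ⟨_, rfl⟩
    obtain ⟨s₁, hs₁⟩ : ∃ s₁, s₁ = Real.exp (2 * Q / D) / (2 * Real.pi) := ⟨_, rfl⟩
    have hs₁0 : 0 < s₁ := by rw [hs₁]; positivity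
    -- The second bound gives `2 s₁ β (K + 1) < cB/8`, while an optimum with `σ² ≥ ε` would need at
    -- least `(B - β)(R - r) ≥ cB/4`. The `+ 1` avoids division by zero.
    refine ⟨min (B / 2) (c * B / (16 * s₁ * (K + 1))), by positivity, fun β hβ hβ₀ p hp => ?_⟩
    have hβ1 : β < B / 2 := hβ₀.trans_le (min_le_left _ _)
    have hβ2 : β < c * B / (16 * s₁ * (K + 1)) := hβ₀.trans_le (min_le_right _ _)
    have hβB : β < B := by linarith
    by_contra! hεv
    have hv : p.encVar ≠ 0 := fun h => by
      rw [h, NNReal.coe_zero] at hεv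
      linarith
    have hs0 : (0 : ℝ) < p.decVar := hS _ hp.1
    have hpK := p.meanDiv_nonneg μ hv
    -- Two comparisons with `q`: decoder variance `s₀` bounds that of `p`; the decoder variance of
    -- `p` itself cancels the logarithms and compares the reconstruction errors.
    obtain ⟨hpR, h0⟩ := hp.le_of_encVar_ne_zero hcov hβ.le hβB hS hv
      (q := { q with decVar := s₀ }) hs₀ hqv hqt
    obtain ⟨-, h1⟩ := hp.le_of_encVar_ne_zero hcov hβ.le hβB hS hv
      (q := { q with decVar := p.decVar }) hp.1 hqv hqt
    change (B - β) * -(D * Real.log (2 * Real.pi * s₀) / 2) -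
      ((B - β) / (2 * s₀) * r + β * K) ≤ _ at h0
    change (B - β) * -(D * Real.log (2 * Real.pi * p.decVar) / 2) -
      ((B - β) / (2 * p.decVar) * r + β * K) ≤ _ at h1
    set R := (p.reconError μ).toReal with hRdef
    have hR0 : 0 ≤ R := ENNReal.toReal_nonneg
    have hBβ : 0 < B - β := sub_pos.2 hβB
    have hscale := p.second_moment_eq_of_le_rescale hd μ hv fun a ha => by
      obtain ⟨-, h2⟩ := hp.le_of_encVar_ne_zero hcov hβ.le hβB hS hv (q := p.rescale a) hp.1
        (mul_ne_zero (pow_ne_zero _ ha) hv) (by rwa [p.reconError_rescale μ ha])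
      rw [p.reconError_rescale μ ha] at h2
      change (B - β) * -(D * Real.log (2 * Real.pi * p.decVar) / 2) -
        ((B - β) / (2 * p.decVar) * R + _) ≤ _ at h2
      exact le_of_mul_le_mul_left (by linarith) hβ
    have hd0 : (0 : ℝ) < d := by exact_mod_cast hd
    have hI : 0 ≤ ∫ x, ‖p.encMean x‖ ^ 2 ∂μ := integral_nonneg fun _ => sq_nonneg _
    have hv1 : (p.encVar : ℝ) ≤ 1 := le_of_mul_le_mul_left (by linarith) hd0
    have hI1 : ∫ x, ‖p.encMean x‖ ^ 2 ∂μ ≤ d := by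
      have : 0 ≤ d * (p.encVar : ℝ) := by positivity
      linarith
    have hcR : c ≤ R := (ENNReal.ofReal_le_iff_le_toReal hpR).1 (hlow p hεv hv1 hI1)
    have hs : (p.decVar : ℝ) ≤ s₁ := by
      have h3 : (B - β) * (D * Real.log (2 * Real.pi * p.decVar) / 2) ≤ (B - β) * Q := by
        have h4 : 0 ≤ (B - β) / (2 * p.decVar) * R + β * p.meanDiv μ := by positivity
        have h5 : β * K ≤ (B - β) * K := mul_le_mul_of_nonneg_right (by linarith) hqK
        have h6 : (B - β) * Q = (B - β) * (D * Real.log (2 * Real.pi * s₀) / 2) +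
          (B - β) / (2 * s₀) * r + (B - β) * K := by rw [hQ]; ring
        linarith
      have h4 := le_of_mul_le_mul_left h3 hBβ
      have h5 : Real.log (2 * Real.pi * p.decVar) ≤ 2 * Q / D := by
        rw [le_div_iff₀ hD]; linarith
      rw [Real.log_le_iff_le_exp (by positivity)] at h5
      rw [hs₁, le_div_iff₀ (by positivity)]
      linarith
    have h3 : (B - β) * R ≤ (B - β) * r + 2 * p.decVar * (β * K) := by
      have h4 : (B - β) / (2 * p.decVar) * R ≤ (B - β) / (2 * p.decVar) * r + β * K := by
        have : 0 ≤ β * p.meanDiv μ := by positivity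
        linarith
      have h5 := mul_le_mul_of_nonneg_left h4 (show 0 ≤ 2 * (p.decVar : ℝ) by positivity)
      field_simp at h5
      linarith
    have h4 : 2 * p.decVar * (β * K) ≤ 2 * s₁ * (β * (K + 1)) := by gcongr; linarith
    have h5 : 16 * (s₁ * (β * (K + 1))) < c * B := by
      rw [lt_div_iff₀ (by positivity)] at hβ2
      linarith
    have h6 : (B - β) * (R - r) ≥ B / 2 * (c / 2) :=
      mul_le_mul (by linarith) (by linarith) (by positivity) hBβ.le
    nlinarith
  · by_contra hv
    have hv0 : (0 : ℝ) < p.encVar := NNReal.coe_pos.2 (pos_iff_ne_zero.2 hv)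
    -- At `β = 0` the objective does not see the latent scale, but the second moment and variance of
    -- this single `p` serve as the bounds.
    obtain ⟨c, hc, hlow⟩ := exists_ofReal_le_reconError d μ hcov hnd
      (∫ x, ‖p.encMean x‖ ^ 2 ∂μ) p.encVar hv0
    obtain ⟨q, hqv, hqR⟩ := exists_reconError_lt hd μ hcov hc
    have hqt : q.reconError μ ≠ ∞ := (hqR.trans ENNReal.ofReal_lt_top).ne
    have hs0 : (0 : ℝ) < p.decVar := hS _ hp.1
    obtain ⟨hpR, h1⟩ := hp.le_of_encVar_ne_zero hcov le_rfl hB hS hv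
      (q := { q with decVar := p.decVar }) hp.1 hqv hqt
    change _ - (_ / (2 * (p.decVar : ℝ)) * (q.reconError μ).toReal + _) ≤ _ at h1
    have h2 := (hqR.trans_le (hlow p le_rfl le_rfl le_rfl))
    have h3 := (ENNReal.toReal_lt_toReal hqt hpR).2 h2
    have h4 : (B - 0) / (2 * (p.decVar : ℝ)) * (q.reconError μ).toReal <
        (B - 0) / (2 * p.decVar) * (p.reconError μ).toReal := by
      rw [sub_zero]; gcongr
    change (B - 0) * -(D * Real.log (2 * Real.pi * p.decVar) / 2) - _ ≤ _ at h1
    linarith
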